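/- Let $a,t>0$, $d<0$ and $b,r\in\mathbb R$, and define polynomials $W_n(x)\in\mathbb R[x]$, $n\ge 0$, by $$W_0(x)=1,\qquad W_1(x)=t(x-r),\qquad W_n(x)=(ax+b)W_{n-1}(x)+d\,W_{n-2}(x)\quad(n\ge 2).$$ Then for every $n\ge0$ the polynomial $W_n$ has degree $n$, and all its complex roots are real and pairwise distinct (simple). Let $\xi_{n,1}<\xi_{n,2}<\dots<\xi_{n,n}$ be its roots in increasing order. Then the roots of $W_{n+1}$ strictly interlace those of $W_n$ for every $n\ge 0$: $$\xi_{n+1,1}<\xi_{n,1}<\xi_{n+1,2}<\xi_{n,2}<\dots<\xi_{n,n}<\xi_{n+1,n+1}.$$ Define $$r^\pm=-\frac ba\pm\frac{|a-2t|\sqrt{-d}}{at},\qquad x_\Delta^\pm=\frac{-b\pm2\sqrt{-d}}{a},$$ $$\xi^\pm=\begin{cases}\dfrac{t(ar-b-2rt)\pm\sqrt{t^2(ar+b)^2-4dt(a-t)}}{2t(a-t)}, & a\ne t,\\[2ex] r-\dfrac{d}{a(ar+b)}, & a=t,\ ar+b\ne0,\end{cases}$$ where $\xi^\pm$ are used only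 in cases in which these expressions are well defined and real. Write $u_n\searrow u$ (respectively $u_n\nearrow u$) if the sequence $(u_n)$, over all $n$ for which $u_n$ is defined, is strictly decreasing (respectively strictly increasing) and converges to $u$ as $n\to\infty$. Then for every $j\ge2$, $$\xi_{n,j}\searrow x_\Delta^-\qquad\text{and}\qquad \xi_{n,n+1-j}\nearrow x_\Delta^+ \qquad (n\ge j,\ n\to\infty).$$ Moreover: (i) if $r\in[r^-,r^+]$ and $a\le 2t$, then $\xi_{n,1}\searrow x_\Delta^-$ and $\xi_{n,n}\nearrow x_\Delta^+$; (ii) if $r\in(r^-,r^+)$ and $a>2t$, then $\xi_{n,1}\searrow \xi^-$ and $\xi_{n,n}\nearrow \xi^+$; (iii) if $r=r^-$ and $a>2t$, or if $r<r^-$, then $\xi_{n,1}\searrow \xi^-$ and $\xi_{n,n}\nearrow x_\Delta^+$; (iv) if $r=r^+$ and $a>2t$, or if $r>r^+$, then $\xi_{n,1}\searrow x_\Delta^-$ and $\xi_{n,n}\nearrow \xi^+$. -/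

import Mathlib

open Polynomial Filter Topology

noncomputable section

/-- The polynomials with `W 0 = 1`, `W 1 = t (x - r)` and
`W (n+2) = (a x + b) W (n+1) + d W n`. -/
def recPoly (a b d t r : ℝ) : ℕ → ℝ[X]
  | 0 => 1
  | 1 => C t * (X - C r)
  | (n + 2) => (C a * X + C b) * recPoly a b d t r (n + 1) + C d * recPoly a b d t r n

/-- All complex roots of `p`, counted with multiplicity, are distinct and real. -/
def IsDistinctRealRooted (p : ℝ[X]) : Prop :=
  (p.map (algebraMap ℝ ℂ)).roots.Nodup ∧ ∀ z : ℂ, aeval z p = 0 → ∃ x : ℝ, z = (x : ℂ)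

/-- The set of real roots of a (nonzero) real polynomial. -/
def zeroSet (p : ℝ[X]) : Finset ℝ := p.roots.toFinset

/-- The `j`-th smallest element of `S`, for `1 ≤ j ≤ S.card` (the value for other `j` is
irrelevant). -/
def nthSmallest (S : Finset ℝ) (j : ℕ) : ℝ := (S.sort (· ≤ ·)).getD (j - 1) 0

/-- `S = {x₁ < ⋯ < xₙ₊₁}` interlaces `T = {y₁ < ⋯ < yₙ}`:
`x₁ < y₁ < x₂ < y₂ < ⋯ < yₙ < xₙ₊₁`. -/
def Interlaces (S T : Finset ℝ) : Prop :=
  S.card = T.card + 1 ∧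
    ∀ j : ℕ, 1 ≤ j → j ≤ T.card →
      nthSmallest S j < nthSmallest T j ∧ nthSmallest T j < nthSmallest S (j + 1)

/-- The sequence `(u n)`, `n ≥ N`, decreases strictly and converges to `l`. -/
def DecreasesTo (N : ℕ) (u : ℕ → ℝ) (l : ℝ) : Prop :=
  StrictAntiOn u (Set.Ici N) ∧ Tendsto u atTop (𝓝 l)

/-- The sequence `(u n)`, `n ≥ N`, increases strictly and converges to `l`. -/
def IncreasesTo (N : ℕ) (u : ℕ → ℝ) (l : ℝ) : Prop :=
  StrictMonoOn u (Set.Ici N) ∧ Tendsto u atTop (𝓝 l)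

/-- The `j`-th smallest root of `recPoly a b d t r n`. -/
def recRoot (a b d t r : ℝ) (n j : ℕ) : ℝ :=
  nthSmallest (zeroSet (recPoly a b d t r n)) j

/-- The number `r⁻`. -/
def rMinus (a b d t : ℝ) : ℝ := -(b / a) - |a - 2 * t| * √(-d) / (a * t)

/-- The number `r⁺`. -/
def rPlus (a b d t : ℝ) : ℝ := -(b / a) + |a - 2 * t| * √(-d) / (a * t)

/-- The smaller root `x_Δ⁻` of `(a x + b)² + 4 d`. -/
def xDeltaMinus (a b d : ℝ) : ℝ := (-b - 2 * √(-d)) / a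

/-- The larger root `x_Δ⁺` of `(a x + b)² + 4 d`. -/
def xDeltaPlus (a b d : ℝ) : ℝ := (-b + 2 * √(-d)) / a

open Classical in
/-- The number `ξ⁻` (not defined, hence of irrelevant value, if `a = t` and `a r + b = 0`). -/
def xiMinus (a b d t r : ℝ) : ℝ :=
  if a = t then r - d / (a * (a * r + b))
  else (t * (a * r - b - 2 * r * t) - √(t ^ 2 * (a * r + b) ^ 2 - 4 * d * t * (a - t))) /
    (2 * t * (a - t))

open Classical in
/-- The number `ξ⁺` (not defined, hence of irrelevant value, if `a = t` and `a r + b = 0`). -/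
def xiPlus (a b d t r : ℝ) : ℝ :=
  if a = t then r - d / (a * (a * r + b))
  else (t * (a * r - b - 2 * r * t) + √(t ^ 2 * (a * r + b) ^ 2 - 4 * d * t * (a - t))) /
    (2 * t * (a - t))

end

/-!
Write `s = √(-d)` and `h = a x + b`, so that the recurrence at `x` has the characteristic equation
`λ² = h λ + d`. It is oscillatory exactly for `x` between `x_Δ⁻` and `x_Δ⁺`, where `h = 2 s cos θ`.

*Bulk roots.* At the points with `θ = k π / (n + 1)`, `1 ≤ k ≤ n`, the trigonometric solution gives
`W (n + 1) = (-1) ^ k s ^ (n + 1)`, whatever `t` and `r` are (`eval_recPoly_oscPoint`). These `n`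
alternating signs, together with the signs at `±∞`, produce `n + 1` simple real roots separated by
the nodes (`card_zeroSet_of_alternating`). The `j`-th node tends to `x_Δ⁻`, so for `j ≥ 2` the
`j`-th root is squeezed between two sequences with that limit.

*Interlacing.* At a root of `W (n + 1)` one has `W (n + 2) = d W n`, so the same alternation lemma,
applied at the roots of `W (n + 1)`, gives the interlacing by induction. Monotonicity in `n` of the
`j`-th root is a part of it.

*Smallest root.* It is bounded above by the first node, so it tends to `x_Δ⁻` unless it escapes
below. On `x ≤ x_Δ⁻` both characteristic roots are negative, say `-m ≥ -l` with `m ≤ s ≤ l`. If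
`W 1 ≤ -s` at `x_Δ⁻`, then `(-1) ^ n W n` stays positive on that half-line (`recPoly_sign_of_le`)
and there is no escape. Otherwise there is a point `ξ < x_Δ⁻` with `W 1 = -m`, where
`W n = (-m) ^ n`; to the left of `ξ` the values `(-1) ^ n W n` stay positive, and immediately to its
right they become negative (`recPoly_sign_eventually`), so the smallest root tends to `ξ`. The
quadratic equation for `W 1` at `ξ` identifies `ξ` with `ξ⁻` (`xiMinus_spec`). Which alternative
holds depends on the position of `r` relative to `rThreshold`, which is `r⁻` for `a ≤ 2 t` and `r⁺`
for `a ≥ 2 t`.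

*Largest roots.* The reflection `x ↦ -x`, `b ↦ -b`, `r ↦ -r` turns them into smallest ones
(`recRoot_neg`).
-/

/-! ### Enumeration of a finite set of reals -/

theorem nthSmallest_eq_orderEmbOfFin {S : Finset ℝ} {n j : ℕ} (hS : S.card = n) (hj : 1 ≤ j)
    (hjn : j ≤ n) : nthSmallest S j = S.orderEmbOfFin hS ⟨j - 1, by omega⟩ := by
  have h : j - 1 < (S.sort (· ≤ ·)).length := by rw [Finset.length_sort]; omega
  rw [nthSmallest, Finset.orderEmbOfFin_apply, List.getD_eq_getElem _ _ h]
  rfl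

theorem nthSmallest_mem {S : Finset ℝ} {j : ℕ} (hj : 1 ≤ j) (hjn : j ≤ S.card) :
    nthSmallest S j ∈ S := by
  rw [nthSmallest_eq_orderEmbOfFin rfl hj hjn]
  exact S.orderEmbOfFin_mem rfl _

theorem nthSmallest_strictMonoOn (S : Finset ℝ) :
    StrictMonoOn (nthSmallest S) (Set.Icc 1 S.card) := by
  intro i hi j hj hij
  rw [nthSmallest_eq_orderEmbOfFin rfl hi.1 hi.2, nthSmallest_eq_orderEmbOfFin rfl hj.1 hj.2]
  refine (S.orderEmbOfFin rfl).strictMono ?_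
  have := hi.1
  simp only [Fin.mk_lt_mk]
  omega

/-- A strictly increasing enumeration of `S` by `1, …, S.card` is the one by `nthSmallest`. -/
theorem nthSmallest_eq_of_strictMonoOn {S : Finset ℝ} {f : ℕ → ℝ}
    (hf : StrictMonoOn f (Set.Icc 1 S.card)) (hmem : ∀ j ∈ Set.Icc 1 S.card, f j ∈ S) {j : ℕ}
    (hj : j ∈ Set.Icc 1 S.card) : nthSmallest S j = f j := by
  have hu : (fun i : Fin S.card => f (i + 1)) = S.orderEmbOfFin rfl := by
    apply Finset.orderEmbOfFin_unique
    · intro i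
      exact hmem _ ⟨by omega, i.2⟩
    · intro i k hik
      have : (i : ℕ) < k := hik
      exact hf ⟨by omega, i.2⟩ ⟨by omega, k.2⟩ (by omega)
  rw [nthSmallest_eq_orderEmbOfFin rfl hj.1 hj.2, ← hu]
  have := hj.1
  simp only
  congr 1
  omega

theorem image_nthSmallest (S : Finset ℝ) :
    (Finset.Icc 1 S.card).image (nthSmallest S) = S := by
  apply Finset.eq_of_subset_of_card_le
  · intro x hx
    obtain ⟨j, hj, rfl⟩ := Finset.mem_image.1 hx
    rw [Finset.mem_Icc] at hj
    exact nthSmallest_mem hj.1 hj.2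
  · rw [Finset.card_image_of_injOn]
    · simp
    · rw [Finset.coe_Icc]
      exact (nthSmallest_strictMonoOn S).injOn

/-! ### Simple real roots and alternating signs -/

theorem mem_zeroSet {p : ℝ[X]} (hp : p ≠ 0) {x : ℝ} : x ∈ zeroSet p ↔ p.eval x = 0 := by
  simp [zeroSet, hp]

theorem card_zeroSet_le (p : ℝ[X]) : (zeroSet p).card ≤ p.natDegree :=
  (Multiset.toFinset_card_le _).trans p.card_roots'

theorem roots_of_card_zeroSet {p : ℝ[X]} (h : (zeroSet p).card = p.natDegree) :
    p.roots.Nodup ∧ p.roots.card = p.natDegree := by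
  have h1 := Multiset.toFinset_card_le p.roots
  have h2 := p.card_roots'
  have h3 : p.roots.toFinset.card = p.natDegree := h
  exact ⟨Multiset.toFinset_card_eq_card_iff_nodup.1 (by omega), by omega⟩

theorem isDistinctRealRooted_of_card_zeroSet {p : ℝ[X]} (hp : p ≠ 0)
    (h : (zeroSet p).card = p.natDegree) : IsDistinctRealRooted p := by
  obtain ⟨hnd, hc⟩ := roots_of_card_zeroSet h
  have hs : p.Splits := splits_iff_card_roots.2 hc
  have hr := hs.roots_map (algebraMap ℝ ℂ)
  refine ⟨?_, fun z hz => ?_⟩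
  · rw [hr]
    exact hnd.map (algebraMap ℝ ℂ).injective
  · have : z ∈ (p.map (algebraMap ℝ ℂ)).roots := by
      rw [mem_roots (Polynomial.map_ne_zero hp)]
      simpa [IsRoot, aeval_def, eval_map] using hz
    rw [hr, Multiset.mem_map] at this
    obtain ⟨x, -, hx⟩ := this
    exact ⟨x, hx.symm⟩

theorem exists_lt_and_eval_pos {p : ℝ[X]} (hdeg : p.natDegree ≠ 0) (hlc : 0 < p.leadingCoeff)
    (u : ℝ) : ∃ M, u < M ∧ 0 < p.eval M := by
  have ht := p.tendsto_atTop_of_leadingCoeff_nonneg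
    (natDegree_pos_iff_degree_pos.1 (Nat.pos_of_ne_zero hdeg)) hlc.le
  obtain ⟨M, h1, h2⟩ := ((eventually_gt_atTop u).and (ht.eventually (eventually_gt_atTop 0))).exists
  exact ⟨M, h1, h2⟩

theorem exists_gt_and_eval_sign {p : ℝ[X]} (hdeg : p.natDegree ≠ 0) (hlc : 0 < p.leadingCoeff)
    (u : ℝ) : ∃ m, m < u ∧ 0 < (-1) ^ p.natDegree * p.eval m := by
  have h0 : ((-1 : ℝ)) ^ p.natDegree ≠ 0 := by simp
  have hn : (C ((-1 : ℝ) ^ p.natDegree) * p.comp (-X)).natDegree = p.natDegree := by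
    rw [natDegree_C_mul h0, natDegree_comp]; simp
  have hl : (C ((-1 : ℝ) ^ p.natDegree) * p.comp (-X)).leadingCoeff = p.leadingCoeff := by
    rw [leadingCoeff_mul, leadingCoeff_C, leadingCoeff_comp (by simp)]
    simp only [leadingCoeff_neg, leadingCoeff_X]
    rw [mul_left_comm, ← mul_pow]
    simp
  obtain ⟨M, h1, h2⟩ := exists_lt_and_eval_pos (hn.symm ▸ hdeg) (hl.symm ▸ hlc) (-u)
  exact ⟨-M, by linarith, by simpa using h2⟩

/-- A polynomial of degree `n + 1` whose signs alternate at `z 1 < ⋯ < z n`, being negative at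
`z n`, has `n + 1` simple real roots, and these are separated by the `z j`. -/
theorem card_zeroSet_of_alternating {p : ℝ[X]} {n : ℕ} (hdeg : p.natDegree = n + 1)
    (hlc : 0 < p.leadingCoeff) {z : ℕ → ℝ} (hz : StrictMonoOn z (Set.Icc 1 n))
    (hsign : ∀ j ∈ Set.Icc 1 n, 0 < (-1) ^ (n + 1 - j) * p.eval (z j)) :
    (zeroSet p).card = n + 1 ∧ ∀ j ∈ Set.Icc 1 n,
      nthSmallest (zeroSet p) j < z j ∧ z j < nthSmallest (zeroSet p) (j + 1) := by
  have hp : p ≠ 0 := by rintro rfl; simp at hdeg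
  obtain ⟨M, hM, hM'⟩ := exists_lt_and_eval_pos (by omega) hlc (z n)
  obtain ⟨m, hm, hm'⟩ := exists_gt_and_eval_sign (by omega) hlc (min (z 1) M)
  rw [hdeg] at hm'
  rw [lt_min_iff] at hm
  -- `y` is `z` with a point added on either side
  let y : ℕ → ℝ := fun j => if j = 0 then m else if j = n + 1 then M else z j
  have hy : ∀ j ∈ Set.Icc 1 n, y j = z j := by
    rintro j ⟨h1, h2⟩
    simp only [y]
    rw [if_neg (by omega), if_neg (by omega)]
  have hy0 : y 0 = m := by simp [y]
  have hyn : y (n + 1) = M := by simp [y]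
  have hstep : ∀ j ≤ n, y j < y (j + 1) := by
    intro j hj
    rcases Nat.eq_zero_or_pos j with rfl | hj0
    · rcases Nat.eq_zero_or_pos n with rfl | hn
      · rw [hy0, hyn]; exact hm.2
      · rw [hy0, hy _ ⟨by omega, by omega⟩]; exact hm.1
    · rcases hj.eq_or_lt with rfl | hjn
      · rw [hyn, hy _ ⟨by omega, by omega⟩]; exact hM
      · rw [hy _ ⟨by omega, by omega⟩, hy _ ⟨by omega, by omega⟩]
        exact hz ⟨by omega, by omega⟩ ⟨by omega, by omega⟩ (by omega)
  have hysign : ∀ j ≤ n + 1, 0 < (-1) ^ (n + 1 - j) * p.eval (y j) := by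
    intro j hj
    rcases Nat.eq_zero_or_pos j with rfl | hj0
    · rw [hy0]; exact hm'
    · rcases hj.eq_or_lt with rfl | hjn
      · rw [hyn]; simpa using hM'
      · rw [hy _ ⟨by omega, by omega⟩]
        exact hsign _ ⟨by omega, by omega⟩
  have hroot : ∀ j, ∃ x, j ≤ n → y j < x ∧ x < y (j + 1) ∧ p.eval x = 0 := by
    intro j
    by_cases hj : j ≤ n
    · have h1 := hysign j (by omega)
      have h2 := hysign (j + 1) (by omega)
      have hc : ContinuousOn (fun x => (-1 : ℝ) ^ (n + 1 - j) * p.eval x)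
          (Set.Icc (y j) (y (j + 1))) := by fun_prop
      have h3 : (-1 : ℝ) ^ (n + 1 - j) * p.eval (y (j + 1)) < 0 := by
        rw [show n + 1 - j = (n + 1 - (j + 1)) + 1 by omega, pow_succ]
        linarith
      obtain ⟨x, hx, hx0⟩ := intermediate_value_Ioo' (hstep j hj).le hc ⟨h3, h1⟩
      refine ⟨x, fun _ => ⟨hx.1, hx.2, ?_⟩⟩
      simpa using hx0
    · exact ⟨0, fun h => absurd h hj⟩
  choose f hf using hroot
  have hfmono : StrictMonoOn (fun j => f (j - 1)) (Set.Icc 1 (n + 1)) := by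
    have hymono : ∀ k l, k ≤ l → l ≤ n + 1 → y k ≤ y l := by
      intro k l hkl
      induction l, hkl using Nat.le_induction with
      | base => intro _; exact le_rfl
      | succ l _ ih => intro hl; exact (ih (by omega)).trans (hstep l (by omega)).le
    rintro i ⟨hi, hi'⟩ j ⟨hj, hj'⟩ hij
    have h1 := (hf (i - 1) (by omega)).2.1
    have h2 := (hf (j - 1) (by omega)).1
    exact h1.trans_le ((hymono _ _ (by omega) (by omega)).trans h2.le)
  have hfmem : ∀ j ∈ Set.Icc 1 (n + 1), f (j - 1) ∈ zeroSet p := by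
    rintro j ⟨h1, h2⟩
    exact (mem_zeroSet hp).2 (hf (j - 1) (by omega)).2.2
  have hcard : (zeroSet p).card = n + 1 := by
    refine le_antisymm (hdeg ▸ card_zeroSet_le p) ?_
    have : ((Finset.Icc 1 (n + 1)).image fun j => f (j - 1)).card ≤ (zeroSet p).card := by
      refine Finset.card_le_card fun x hx => ?_
      obtain ⟨j, hj, rfl⟩ := Finset.mem_image.1 hx
      exact hfmem j (Finset.mem_Icc.1 hj)
    rw [Finset.card_image_of_injOn (by rw [Finset.coe_Icc]; exact hfmono.injOn)] at this
    simpa using this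
  refine ⟨hcard, ?_⟩
  rintro j ⟨h1, h2⟩
  have heq : ∀ j ∈ Set.Icc 1 (n + 1), nthSmallest (zeroSet p) j = f (j - 1) := fun j hj =>
    nthSmallest_eq_of_strictMonoOn (f := fun j => f (j - 1)) (hcard ▸ hfmono) (hcard ▸ hfmem)
      (hcard ▸ hj)
  rw [heq j ⟨h1, by omega⟩, heq (j + 1) ⟨by omega, by omega⟩, ← hy j ⟨h1, h2⟩]
  have h3 := (hf (j - 1) (by omega)).2.1
  rw [Nat.sub_add_cancel h1] at h3
  exact ⟨h3, (hf j h2).1⟩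

/-- The sign of a polynomial with simple real roots only, between its `j`-th and its `(j + 1)`-th
root. For `j = 0` and `j = n` one of the two bounds is void. -/
theorem eval_sign_of_card_zeroSet {p : ℝ[X]} {n : ℕ} (hdeg : p.natDegree = n)
    (hlc : 0 < p.leadingCoeff) (hcard : (zeroSet p).card = n) {j : ℕ} (hj : j ≤ n) {y : ℝ}
    (h1 : 1 ≤ j → nthSmallest (zeroSet p) j < y)
    (h2 : j < n → y < nthSmallest (zeroSet p) (j + 1)) :
    0 < (-1) ^ (n - j) * p.eval y := by
  obtain ⟨hnd, hc⟩ := roots_of_card_zeroSet (hcard.trans hdeg.symm)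
  have hmono := nthSmallest_strictMonoOn (zeroSet p)
  rw [hcard] at hmono
  have heval : p.eval y = p.leadingCoeff *
      ∏ i ∈ Finset.Icc 1 n, (y - nthSmallest (zeroSet p) i) := by
    conv_lhs => rw [← C_leadingCoeff_mul_prod_multiset_X_sub_C hc]
    rw [eval_mul, eval_C, eval_multiset_prod, Multiset.map_map]
    congr 1
    have : ∏ x ∈ zeroSet p, (y - x) = ∏ i ∈ Finset.Icc 1 n, (y - nthSmallest (zeroSet p) i) := by
      conv_lhs => rw [← image_nthSmallest (zeroSet p), hcard]
      exact Finset.prod_image (by rw [Finset.coe_Icc]; exact hmono.injOn)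
    rw [← this, Finset.prod_eq_multiset_prod, zeroSet, Multiset.toFinset_val, hnd.dedup]
    simp
  have hpow : (-1 : ℝ) ^ (n - j) = ∏ i ∈ Finset.Icc 1 n, if i ≤ j then (1 : ℝ) else -1 := by
    rw [Finset.prod_ite]
    simp only [Finset.prod_const_one, one_mul, Finset.prod_const]
    congr 1
    have : (Finset.Icc 1 n).filter (fun i => ¬ i ≤ j) = Finset.Icc (j + 1) n := by
      ext i; simp only [Finset.mem_filter, Finset.mem_Icc]; omega
    rw [this, Nat.card_Icc]; omega
  rw [heval, mul_left_comm, hpow, ← Finset.prod_mul_distrib]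
  refine mul_pos hlc (Finset.prod_pos fun i hi => ?_)
  obtain ⟨hi1, hin⟩ := Finset.mem_Icc.1 hi
  split_ifs with hij
  · have h3 : nthSmallest (zeroSet p) i ≤ nthSmallest (zeroSet p) j :=
      hmono.monotoneOn ⟨hi1, hin⟩ ⟨by omega, hj⟩ hij
    have := h1 (by omega)
    linarith
  · have h3 : nthSmallest (zeroSet p) (j + 1) ≤ nthSmallest (zeroSet p) i :=
      hmono.monotoneOn ⟨by omega, by omega⟩ ⟨hi1, hin⟩ (by omega)
    have := h2 (by omega)
    linarith

/-! ### Degree and recurrence -/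

theorem recPoly_add_two (a b d t r : ℝ) (n : ℕ) : recPoly a b d t r (n + 2) =
    (C a * X + C b) * recPoly a b d t r (n + 1) + C d * recPoly a b d t r n := rfl

theorem eval_recPoly_zero (a b d t r x : ℝ) : (recPoly a b d t r 0).eval x = 1 := by
  simp [recPoly]

theorem eval_recPoly_one (a b d t r x : ℝ) : (recPoly a b d t r 1).eval x = t * (x - r) := by
  simp [recPoly]

theorem eval_recPoly_add_two (a b d t r x : ℝ) (n : ℕ) : (recPoly a b d t r (n + 2)).eval x =
    (a * x + b) * (recPoly a b d t r (n + 1)).eval x + d * (recPoly a b d t r n).eval x := by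
  simp [recPoly_add_two]

theorem degree_and_leadingCoeff_recPoly {a t : ℝ} (b d r : ℝ) (ha : 0 < a) (ht : 0 < t) (n : ℕ) :
    (recPoly a b d t r n).degree = n ∧ 0 < (recPoly a b d t r n).leadingCoeff := by
  induction n using Nat.twoStepInduction with
  | zero => simp [recPoly]
  | one =>
    constructor
    · simp [recPoly, ht.ne']
    · simp [recPoly, ht]
  | more n ih0 ih1 =>
    have h1 : ((C a * X + C b) * recPoly a b d t r (n + 1)).degree = ((n + 2 : ℕ) : WithBot ℕ) := by
      rw [degree_mul, degree_linear ha.ne', ih1.1]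
      norm_cast
      ring
    have h2 : (C d * recPoly a b d t r n).degree <
        ((C a * X + C b) * recPoly a b d t r (n + 1)).degree := by
      rw [h1]
      refine ((degree_mul_le _ _).trans (add_le_add degree_C_le le_rfl)).trans_lt ?_
      rw [ih0.1, zero_add]
      exact_mod_cast (by omega : n < n + 2)
    rw [recPoly_add_two, degree_add_eq_left_of_degree_lt h2, leadingCoeff_add_of_degree_lt' h2,
      leadingCoeff_mul, leadingCoeff_linear ha.ne']
    exact ⟨h1, mul_pos ha ih1.2⟩

theorem natDegree_recPoly {a t : ℝ} (b d r : ℝ) (ha : 0 < a) (ht : 0 < t) (n : ℕ) :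
    (recPoly a b d t r n).natDegree = n :=
  natDegree_eq_of_degree_eq_some (degree_and_leadingCoeff_recPoly b d r ha ht n).1

theorem leadingCoeff_recPoly_pos {a t : ℝ} (b d r : ℝ) (ha : 0 < a) (ht : 0 < t) (n : ℕ) :
    0 < (recPoly a b d t r n).leadingCoeff :=
  (degree_and_leadingCoeff_recPoly b d r ha ht n).2

theorem recPoly_ne_zero {a t : ℝ} (b d r : ℝ) (ha : 0 < a) (ht : 0 < t) (n : ℕ) :
    recPoly a b d t r n ≠ 0 := by
  intro h
  have := leadingCoeff_recPoly_pos b d r ha ht n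
  simp [h] at this

/-! ### Values on the oscillatory interval, and the bulk roots -/

/-- The point `x` with `a x + b = 2 √(-d) cos θ`. -/
noncomputable def oscPoint (a b d θ : ℝ) : ℝ := (2 * √(-d) * Real.cos θ - b) / a

theorem mul_oscPoint_add {a : ℝ} (ha : 0 < a) (b d θ : ℝ) :
    a * oscPoint a b d θ + b = 2 * √(-d) * Real.cos θ := by
  rw [oscPoint]; field_simp; ring

/-- The trigonometric solution of the recurrence on the oscillatory interval. -/
theorem eval_recPoly_oscPoint_mul_sin {a d : ℝ} (b t r : ℝ) (ha : 0 < a) (hd : d < 0) (θ : ℝ)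
    (n : ℕ) : (recPoly a b d t r (n + 1)).eval (oscPoint a b d θ) * Real.sin θ =
      √(-d) ^ n * (t * (oscPoint a b d θ - r) * Real.sin ((n + 1) * θ)
        - √(-d) * Real.sin (n * θ)) := by
  have hs : √(-d) ^ 2 = -d := Real.sq_sqrt (by linarith)
  have hd' : d = -√(-d) ^ 2 := by linarith
  have hrec : ∀ m : ℝ, Real.sin ((m + 1 + 1) * θ) =
      2 * Real.cos θ * Real.sin ((m + 1) * θ) - Real.sin (m * θ) := by
    intro m
    have h1 := Real.sin_add ((m + 1) * θ) θ
    have h2 := Real.sin_sub ((m + 1) * θ) θ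
    rw [show (m + 1) * θ + θ = (m + 1 + 1) * θ by ring] at h1
    rw [show (m + 1) * θ - θ = m * θ by ring] at h2
    linarith
  induction n using Nat.twoStepInduction with
  | zero => simp [eval_recPoly_one]
  | one =>
    have h := hrec 0
    simp only [zero_add, zero_mul, Real.sin_zero, sub_zero, one_mul] at h
    rw [eval_recPoly_add_two, eval_recPoly_one, eval_recPoly_zero, mul_oscPoint_add ha]
    push_cast
    rw [h]
    simp only [one_mul, pow_one]
    linear_combination Real.sin θ * hs
  | more n ih0 ih1 =>
    rw [eval_recPoly_add_two, add_mul, mul_assoc, mul_assoc, ih0, ih1, mul_oscPoint_add ha]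
    push_cast
    rw [show (n : ℝ) + 2 = n + 1 + 1 by ring, hrec (n + 1), hrec n]
    generalize √(-d) = s at *
    subst hd'
    ring

theorem eval_recPoly_oscPoint {a d : ℝ} (b t r : ℝ) (ha : 0 < a) (hd : d < 0) {n k : ℕ}
    (hk : 1 ≤ k) (hkn : k ≤ n) :
    (recPoly a b d t r (n + 1)).eval (oscPoint a b d (k * Real.pi / (n + 1))) =
      (-1) ^ k * √(-d) ^ (n + 1) := by
  have hn : (0 : ℝ) < n + 1 := by positivity
  have hk' : (0 : ℝ) < k := by exact_mod_cast hk
  have hkn' : (k : ℝ) < n + 1 := by exact_mod_cast Nat.lt_succ_of_le hkn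
  set θ : ℝ := k * Real.pi / (n + 1) with hθ
  have hsin : 0 < Real.sin θ := by
    apply Real.sin_pos_of_pos_of_lt_pi
    · positivity
    · rw [hθ, div_lt_iff₀ hn, mul_comm]
      exact mul_lt_mul_of_pos_left hkn' Real.pi_pos
  have h1 : ((n : ℝ) + 1) * θ = k * Real.pi := by rw [hθ]; field_simp
  have h2 : (n : ℝ) * θ = k * Real.pi - θ := by linear_combination h1
  have h := eval_recPoly_oscPoint_mul_sin b t r ha hd θ n
  rw [h1, h2, Real.sin_sub, Real.sin_nat_mul_pi, Real.cos_nat_mul_pi] at h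
  apply mul_right_cancel₀ hsin.ne'
  rw [h]
  ring

/-- The nodes `oscPoint a b d (k π / (n + 1))`, `1 ≤ k ≤ n`, in increasing order. -/
noncomputable def oscNode (a b d : ℝ) (n j : ℕ) : ℝ :=
  oscPoint a b d (((n + 1 - j : ℕ) : ℝ) * Real.pi / (n + 1))

theorem strictMonoOn_oscNode {a d : ℝ} (b : ℝ) (ha : 0 < a) (hd : d < 0) (n : ℕ) :
    StrictMonoOn (oscNode a b d n) (Set.Icc 0 (n + 1)) := by
  rintro i ⟨hi, hi'⟩ j ⟨hj, hj'⟩ hij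
  have hs : 0 < √(-d) := Real.sqrt_pos.2 (by linarith)
  have hn : (0 : ℝ) < n + 1 := by positivity
  have hlt : ((n + 1 - j : ℕ) : ℝ) < ((n + 1 - i : ℕ) : ℝ) := by
    exact_mod_cast (by omega : n + 1 - j < n + 1 - i)
  have hle : ((n + 1 - i : ℕ) : ℝ) ≤ n + 1 := by exact_mod_cast (by omega : n + 1 - i ≤ n + 1)
  have hcos : Real.cos (((n + 1 - i : ℕ) : ℝ) * Real.pi / (n + 1)) <
      Real.cos (((n + 1 - j : ℕ) : ℝ) * Real.pi / (n + 1)) := by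
    apply Real.cos_lt_cos_of_nonneg_of_le_pi
    · positivity
    · rw [div_le_iff₀ hn, mul_comm]
      exact mul_le_mul_of_nonneg_left hle Real.pi_pos.le
    · have := Real.pi_pos
      gcongr
  unfold oscNode oscPoint
  gcongr

theorem card_zeroSet_recPoly_succ {a d t : ℝ} (b r : ℝ) (ha : 0 < a) (ht : 0 < t) (hd : d < 0)
    (n : ℕ) : (zeroSet (recPoly a b d t r (n + 1))).card = n + 1 ∧ ∀ j ∈ Set.Icc 1 n,
      recRoot a b d t r (n + 1) j < oscNode a b d n j ∧
      oscNode a b d n j < recRoot a b d t r (n + 1) (j + 1) := by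
  have hs : 0 < √(-d) := Real.sqrt_pos.2 (by linarith)
  refine card_zeroSet_of_alternating (natDegree_recPoly b d r ha ht (n + 1))
    (leadingCoeff_recPoly_pos b d r ha ht (n + 1))
    ((strictMonoOn_oscNode b ha hd n).mono (Set.Icc_subset_Icc (by omega) (by omega))) ?_
  rintro j ⟨h1, h2⟩
  rw [oscNode, eval_recPoly_oscPoint b t r ha hd (by omega) (by omega), ← mul_assoc, ← mul_pow]
  simp only [neg_mul_neg, one_mul, one_pow]
  positivity

theorem card_zeroSet_recPoly {a d t : ℝ} (b r : ℝ) (ha : 0 < a) (ht : 0 < t) (hd : d < 0)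
    (n : ℕ) : (zeroSet (recPoly a b d t r n)).card = n := by
  cases n with
  | zero => simp [recPoly, zeroSet]
  | succ n => exact (card_zeroSet_recPoly_succ b r ha ht hd n).1

theorem eval_recPoly_recRoot {a d t : ℝ} (b r : ℝ) (ha : 0 < a) (ht : 0 < t) (hd : d < 0)
    {n j : ℕ} (hj : 1 ≤ j) (hjn : j ≤ n) :
    (recPoly a b d t r n).eval (recRoot a b d t r n j) = 0 :=
  (mem_zeroSet (recPoly_ne_zero b d r ha ht n)).1
    (nthSmallest_mem hj (by rwa [card_zeroSet_recPoly b r ha ht hd]))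

/-! ### Interlacing and monotonicity -/

theorem interlaces_recPoly {a d t : ℝ} (b r : ℝ) (ha : 0 < a) (ht : 0 < t) (hd : d < 0) (n : ℕ) :
    Interlaces (zeroSet (recPoly a b d t r (n + 1))) (zeroSet (recPoly a b d t r n)) := by
  have hcard := card_zeroSet_recPoly b r ha ht hd
  refine ⟨by rw [hcard, hcard], ?_⟩
  simp only [hcard]
  induction n with
  | zero => intro j h1 h2; omega
  | succ n ih =>
    intro j h1 h2
    refine (card_zeroSet_of_alternating (natDegree_recPoly b d r ha ht (n + 2))
      (leadingCoeff_recPoly_pos b d r ha ht (n + 2))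
      (z := nthSmallest (zeroSet (recPoly a b d t r (n + 1)))) ?_ ?_).2 j ⟨h1, h2⟩
    · have := nthSmallest_strictMonoOn (zeroSet (recPoly a b d t r (n + 1)))
      rwa [hcard] at this
    · rintro j ⟨h1, h2⟩
      have hroot := eval_recPoly_recRoot b r ha ht hd h1 h2
      -- at a root of `W (n + 1)`, the recurrence gives `W (n + 2) = d W n`
      have hsign := eval_sign_of_card_zeroSet (natDegree_recPoly b d r ha ht n)
        (leadingCoeff_recPoly_pos b d r ha ht n) (hcard n) (j := j - 1) (by omega)
        (y := recRoot a b d t r (n + 1) j)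
        (fun hj => by
          have := (ih (j - 1) hj (by omega)).2
          rwa [Nat.sub_add_cancel h1] at this)
        (fun hj => by
          rw [Nat.sub_add_cancel h1]
          exact (ih j h1 (by omega)).1)
      rw [recRoot] at hroot hsign
      rw [eval_recPoly_add_two, hroot, mul_zero, zero_add,
        show n + 1 + 1 - j = n - (j - 1) + 1 by omega, pow_succ]
      nlinarith [mul_pos (neg_pos.2 hd) hsign]

theorem strictAntiOn_recRoot {a d t : ℝ} (b r : ℝ) (ha : 0 < a) (ht : 0 < t) (hd : d < 0) {j : ℕ}
    (hj : 1 ≤ j) : StrictAntiOn (fun n => recRoot a b d t r n j) (Set.Ici j) := by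
  refine strictAntiOn_of_succ_lt Set.ordConnected_Ici fun n _ hn _ => ?_
  exact ((interlaces_recPoly b r ha ht hd n).2 j hj
    (by rw [card_zeroSet_recPoly b r ha ht hd]; exact hn)).1

/-! ### Limits of the bulk roots -/

theorem tendsto_oscNode {a d : ℝ} (b : ℝ) (j : ℕ) :
    Tendsto (fun n => oscNode a b d n j) atTop (𝓝 (xDeltaMinus a b d)) := by
  have h1 : Tendsto (fun n : ℕ => Real.pi - (j * Real.pi) * (1 / ((n : ℝ) + 1))) atTop
      (𝓝 (Real.pi - (j * Real.pi) * 0)) :=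
    (tendsto_one_div_add_atTop_nhds_zero_nat.const_mul _).const_sub _
  rw [mul_zero, sub_zero] at h1
  have hc : Continuous (oscPoint a b d) := by unfold oscPoint; fun_prop
  have h2 := (hc.tendsto Real.pi).comp h1
  have h3 : oscPoint a b d Real.pi = xDeltaMinus a b d := by
    rw [oscPoint, xDeltaMinus, Real.cos_pi]; ring
  rw [h3] at h2
  refine h2.congr' ?_
  filter_upwards [eventually_ge_atTop j] with n hn
  simp only [Function.comp_apply, oscNode]
  congr 1
  have : (n : ℝ) + 1 ≠ 0 := by positivity
  rw [Nat.cast_sub (by omega)]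
  push_cast
  field_simp

theorem xDeltaMinus_lt_oscNode {a d : ℝ} (b : ℝ) (ha : 0 < a) (hd : d < 0) {n j : ℕ} (hj : 1 ≤ j)
    (hjn : j ≤ n) : xDeltaMinus a b d < oscNode a b d n j := by
  have h0 : oscNode a b d n 0 = xDeltaMinus a b d := by
    have : (n : ℝ) + 1 ≠ 0 := by positivity
    rw [oscNode, oscPoint, xDeltaMinus, Nat.sub_zero]
    push_cast
    rw [mul_div_assoc, mul_div_cancel₀ _ this, Real.cos_pi]
    ring
  rw [← h0]
  exact strictMonoOn_oscNode b ha hd n ⟨le_rfl, by omega⟩ ⟨by omega, by omega⟩ (by omega)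

theorem decreasesTo_recRoot_of_lowerBound {a d t : ℝ} (b r : ℝ) (ha : 0 < a) (ht : 0 < t)
    (hd : d < 0) {j : ℕ} (hj : 1 ≤ j)
    (h : ∀ n, j ≤ n → xDeltaMinus a b d ≤ recRoot a b d t r n j) :
    DecreasesTo j (fun n => recRoot a b d t r n j) (xDeltaMinus a b d) := by
  refine ⟨strictAntiOn_recRoot b r ha ht hd hj, ?_⟩
  rw [← tendsto_add_atTop_iff_nat 1]
  refine tendsto_of_tendsto_of_tendsto_of_le_of_le' tendsto_const_nhds (tendsto_oscNode b j) ?_ ?_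
  · filter_upwards [eventually_ge_atTop j] with n hn
    exact h (n + 1) (by omega)
  · filter_upwards [eventually_ge_atTop j] with n hn
    exact ((card_zeroSet_recPoly_succ b r ha ht hd n).2 j ⟨hj, hn⟩).1.le

theorem decreasesTo_recRoot {a d t : ℝ} (b r : ℝ) (ha : 0 < a) (ht : 0 < t) (hd : d < 0) {j : ℕ}
    (hj : 2 ≤ j) : DecreasesTo j (fun n => recRoot a b d t r n j) (xDeltaMinus a b d) := by
  refine decreasesTo_recRoot_of_lowerBound b r ha ht hd (by omega) fun n hn => ?_
  obtain ⟨m, rfl⟩ : ∃ m, n = m + 1 := ⟨n - 1, by omega⟩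
  obtain ⟨i, rfl⟩ : ∃ i, j = i + 1 := ⟨j - 1, by omega⟩
  exact ((xDeltaMinus_lt_oscNode b ha hd (by omega) (by omega)).trans
    ((card_zeroSet_recPoly_succ b r ha ht hd m).2 i ⟨by omega, by omega⟩).2).le

/-! ### The smallest root -/

/-- If `W 1 ≤ -m` at `x` and `-(a x + b)` is at least the sum `m + -d / m` that would make `-m` a
characteristic root of the recurrence, then `(-1) ^ n W n` grows at least like `m ^ n`, hence is
positive. -/
theorem recPoly_sign_of_le {a b d t r m x : ℝ} (hm : 0 < m) (hd : d < 0)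
    (hx : m + -d / m ≤ -(a * x + b)) (h1 : m ≤ t * (r - x)) (n : ℕ) :
    0 < (-1) ^ n * (recPoly a b d t r n).eval x := by
  suffices h : 0 < (-1) ^ n * (recPoly a b d t r n).eval x ∧
      m * ((-1) ^ n * (recPoly a b d t r n).eval x) ≤
        (-1) ^ (n + 1) * (recPoly a b d t r (n + 1)).eval x from h.1
  induction n with
  | zero =>
    rw [eval_recPoly_zero, zero_add, eval_recPoly_one]
    constructor <;> linarith
  | succ n ih =>
    obtain ⟨h0, hle⟩ := ih
    have hpos := (mul_pos hm h0).trans_le hle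
    refine ⟨hpos, ?_⟩
    rw [eval_recPoly_add_two]
    have e : (-1) ^ (n + 1 + 1) * ((a * x + b) * (recPoly a b d t r (n + 1)).eval x +
        d * (recPoly a b d t r n).eval x) =
        -(a * x + b) * ((-1) ^ (n + 1) * (recPoly a b d t r (n + 1)).eval x) +
        d * ((-1) ^ n * (recPoly a b d t r n).eval x) := by ring
    rw [e]
    generalize (-1) ^ (n + 1) * (recPoly a b d t r (n + 1)).eval x = v at *
    generalize (-1) ^ n * (recPoly a b d t r n).eval x = u at *
    have h2 := mul_le_mul_of_nonneg_right hx hpos.le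
    have h3 : -d * u ≤ -d / m * v := by
      rw [div_mul_eq_mul_div, le_div_iff₀ hm]
      nlinarith
    linarith

/-- If `-m` and `-l` are the characteristic roots of the recurrence at `x` and `-m < W 1`, then
`(-1) ^ n W n` is eventually negative. When `m < l` the reason is that its component along the
dominant solution `l ^ n` is negative. -/
theorem recPoly_sign_eventually {a b d t r m l x : ℝ} (hm : 0 < m) (hml : m ≤ l)
    (hsum : m + l = -(a * x + b)) (hprod : m * l = -d) (h1 : t * (r - x) < m) :
    ∀ᶠ n : ℕ in atTop, (-1) ^ n * (recPoly a b d t r n).eval x < 0 := by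
  set c := m - t * (r - x) with hc
  have hc0 : 0 < c := by rw [hc]; linarith
  have hstep : ∀ n : ℕ, (-1) ^ (n + 1) * (recPoly a b d t r (n + 1)).eval x =
      m * ((-1) ^ n * (recPoly a b d t r n).eval x) - c * l ^ n := by
    intro n
    induction n with
    | zero =>
      rw [eval_recPoly_zero, zero_add, eval_recPoly_one, hc]; ring
    | succ n ih =>
      rw [eval_recPoly_add_two]
      have h2 : a * x + b = -(m + l) := by linarith
      have h3 : d = -(m * l) := by linarith
      linear_combination l * ih + (-1) ^ n * (recPoly a b d t r (n + 1)).eval x * h2 +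
        (-1) ^ n * (recPoly a b d t r n).eval x * h3
  have hbound : ∀ n : ℕ, m * ((-1) ^ n * (recPoly a b d t r n).eval x) ≤ m ^ n * (m - n * c) := by
    intro n
    induction n with
    | zero => rw [eval_recPoly_zero]; simp
    | succ n ih =>
      rw [hstep]
      have h2 : m ^ n ≤ l ^ n := pow_le_pow_left₀ hm.le hml n
      have h3 := mul_le_mul_of_nonneg_left h2 (mul_pos hm hc0).le
      have h4 := mul_le_mul_of_nonneg_left ih hm.le
      rw [pow_succ]
      push_cast
      linarith
  filter_upwards [eventually_gt_atTop ⌈m / c⌉₊] with n hn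
  have h2 : m < n * c := by
    rw [← div_lt_iff₀ hc0]
    exact (Nat.le_ceil _).trans_lt (by exact_mod_cast hn)
  have h3 : m ^ n * (m - n * c) < 0 := mul_neg_of_pos_of_neg (pow_pos hm n) (by linarith)
  have h4 := (hbound n).trans_lt h3
  by_contra hcon
  push Not at hcon
  linarith [mul_nonneg hm.le hcon]

/-- The polynomial `(-1) ^ n W n` is positive to the left of all its roots, so a negative value at
`x` puts the smallest root at or before `x`. -/
theorem recRoot_one_le {a d t : ℝ} (b r : ℝ) (ha : 0 < a) (ht : 0 < t) (hd : d < 0) {n : ℕ} {x : ℝ}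
    (hn : 1 ≤ n) (hx : (-1) ^ n * (recPoly a b d t r n).eval x < 0) :
    recRoot a b d t r n 1 ≤ x := by
  by_contra hcon
  push Not at hcon
  have := eval_sign_of_card_zeroSet (natDegree_recPoly b d r ha ht n)
    (leadingCoeff_recPoly_pos b d r ha ht n) (card_zeroSet_recPoly b r ha ht hd n)
    (j := 0) (by omega) (y := x) (fun h => by omega) (fun _ => hcon)
  rw [Nat.sub_zero] at this
  linarith

theorem add_xDeltaMinus {a : ℝ} (b d : ℝ) (ha : 0 < a) :
    -(a * xDeltaMinus a b d + b) = 2 * √(-d) := by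
  rw [xDeltaMinus]; field_simp; ring

/-- The value of `r` at which the smallest roots stop converging to `x_Δ⁻`: it is the one with
`W 1 = -√(-d)` at `x_Δ⁻`. -/
noncomputable def rThreshold (a b d t : ℝ) : ℝ := -(b / a) + (a - 2 * t) * √(-d) / (a * t)

theorem mul_sub_xDeltaMinus {a t : ℝ} (b d r : ℝ) (ha : 0 < a) (ht : 0 < t) :
    t * (r - xDeltaMinus a b d) = √(-d) + t * (r - rThreshold a b d t) := by
  rw [xDeltaMinus, rThreshold]; field_simp; ring

theorem decreasesTo_recRoot_one_of_threshold_le {a d t : ℝ} (b r : ℝ) (ha : 0 < a) (ht : 0 < t)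
    (hd : d < 0) (hr : rThreshold a b d t ≤ r) :
    DecreasesTo 1 (fun n => recRoot a b d t r n 1) (xDeltaMinus a b d) := by
  have hs : 0 < √(-d) := Real.sqrt_pos.2 (by linarith)
  have hss : √(-d) * √(-d) = -d := Real.mul_self_sqrt (by linarith)
  refine decreasesTo_recRoot_of_lowerBound b r ha ht hd le_rfl fun n hn => ?_
  by_contra! hlt
  have h1 := mul_sub_xDeltaMinus b d r ha ht
  have h2 := add_xDeltaMinus b d ha
  have h3 : -d / √(-d) = √(-d) := by rw [div_eq_iff hs.ne', hss]
  have := recPoly_sign_of_le (a := a) (b := b) (t := t) (r := r) hs hd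
    (x := recRoot a b d t r n 1) (by rw [h3]; nlinarith)
    (by nlinarith [mul_nonneg ht.le (sub_nonneg.2 hr)]) n
  rw [eval_recPoly_recRoot b r ha ht hd le_rfl hn] at this
  simp at this

/-- If `-m` with `0 < m < √(-d)` is both the value of `W 1` and the small characteristic root of the
recurrence at `ξ`, so that `W n = (-m) ^ n` there, then the smallest roots tend to `ξ`. -/
theorem decreasesTo_recRoot_one_of_eigenvalue {a b d t r m ξ : ℝ} (ha : 0 < a) (ht : 0 < t)
    (hd : d < 0) (hm : 0 < m) (hms : m < √(-d)) (h1 : t * (r - ξ) = m)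
    (hchar : m * -(a * ξ + b) = m ^ 2 - d) :
    DecreasesTo 1 (fun n => recRoot a b d t r n 1) ξ := by
  have hs : 0 < √(-d) := Real.sqrt_pos.2 (by linarith)
  have hss : √(-d) * √(-d) = -d := Real.mul_self_sqrt (by linarith)
  have hlow : ∀ n, 1 ≤ n → ξ < recRoot a b d t r n 1 := by
    intro n hn
    by_contra! hle
    have h2 : m + -d / m = -(a * ξ + b) := by field_simp; linarith
    have := recPoly_sign_of_le (a := a) (b := b) (t := t) (r := r) hm hd
      (x := recRoot a b d t r n 1) (by rw [h2]; nlinarith) (by nlinarith) n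
    rw [eval_recPoly_recRoot b r ha ht hd le_rfl hn] at this
    simp at this
  have hξΔ : ξ < xDeltaMinus a b d := by
    have h2 := add_xDeltaMinus b d ha
    have h3 : 2 * √(-d) < -(a * ξ + b) := by
      -- `m (2 √(-d)) < m ^ 2 - d` is `0 < (√(-d) - m) ^ 2`
      refine lt_of_mul_lt_mul_left ?_ hm.le
      nlinarith [mul_pos (sub_pos.2 hms) (sub_pos.2 hms)]
    exact lt_of_mul_lt_mul_left (by linarith) ha.le
  refine ⟨strictAntiOn_recRoot b r ha ht hd le_rfl, tendsto_order.2 ⟨fun y hy => ?_, fun y hy => ?_⟩⟩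
  · filter_upwards [eventually_ge_atTop 1] with n hn
    exact hy.trans (hlow n hn)
  · obtain ⟨x, hx1, hx2⟩ := exists_between (lt_min hy hξΔ)
    rw [lt_min_iff] at hx2
    have hH : 2 * √(-d) < -(a * x + b) := by
      have h2 := add_xDeltaMinus b d ha
      nlinarith
    set H := -(a * x + b) with hHdef
    have hdisc : 0 ≤ H ^ 2 + 4 * d := by nlinarith
    have hsq := Real.sq_sqrt hdisc
    have hroot : √(H ^ 2 + 4 * d) < H - 2 * m := by
      rw [Real.sqrt_lt' (by linarith)]
      have : m * H < m ^ 2 - d := by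
        rw [← hchar, hHdef]
        exact mul_lt_mul_of_pos_left (by nlinarith) hm
      linarith
    have hnn := Real.sqrt_nonneg (H ^ 2 + 4 * d)
    have hev := recPoly_sign_eventually (a := a) (b := b) (d := d) (t := t) (r := r) (x := x)
      (m := (H - √(H ^ 2 + 4 * d)) / 2) (l := (H + √(H ^ 2 + 4 * d)) / 2) (by linarith)
      (by linarith) (by linarith) (by linear_combination (-1 / 4) * hsq)
      (by nlinarith)
    filter_upwards [hev, eventually_ge_atTop 1] with n hn hn1
    exact (recRoot_one_le b r ha ht hd hn1 hn).trans_lt hx2.1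

/-- `t (ξ⁻ - r)` is the root in `(-√(-d), 0)` of `(a - t) T ^ 2 + t (a r + b) T + d t`. -/
theorem xiMinus_spec {a b d t r : ℝ} (ht : 0 < t) (hd : d < 0)
    (hr : t * (a * r + b) < (a - 2 * t) * √(-d)) (ha : 0 < a) :
    ∃ m, 0 < m ∧ m < √(-d) ∧ t * (r - xiMinus a b d t r) = m ∧
      m * -(a * xiMinus a b d t r + b) = m ^ 2 - d := by
  have hs : 0 < √(-d) := Real.sqrt_pos.2 (by linarith)
  have hss : √(-d) * √(-d) = -d := Real.mul_self_sqrt (by linarith)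
  have hcont : ContinuousOn (fun T : ℝ => (a - t) * T ^ 2 + t * (a * r + b) * T + d * t)
      (Set.Icc (-√(-d)) 0) := by fun_prop
  obtain ⟨T, ⟨hT1, hT0⟩, hT⟩ := intermediate_value_Ioo' (by linarith) hcont
    (show (0 : ℝ) ∈ Set.Ioo _ _ from ⟨by nlinarith, by nlinarith⟩)
  simp only at hT
  have hξ : xiMinus a b d t r = r + T / t := by
    unfold xiMinus
    split_ifs with hat
    · subst hat
      have hB : (a * r + b) * T = -d := by
        apply mul_left_cancel₀ ht.ne'
        linear_combination hT
      have hne : a * r + b ≠ 0 := by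
        intro h0
        rw [h0] at hB
        linarith
      rw [(eq_div_iff hne).2 ((mul_comm T _).trans hB)]
      field_simp
      ring
    · have hat' : a - t ≠ 0 := sub_ne_zero.2 hat
      -- the quadratic decreases at `T`, which selects the sign of the square root
      have hsq : √(t ^ 2 * (a * r + b) ^ 2 - 4 * d * t * (a - t)) =
          -(2 * (a - t) * T + t * (a * r + b)) := by
        rw [show t ^ 2 * (a * r + b) ^ 2 - 4 * d * t * (a - t) =
          (-(2 * (a - t) * T + t * (a * r + b))) ^ 2 by linear_combination (-4 * (a - t)) * hT]
        apply Real.sqrt_sq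
        have h1 : T ^ 2 < -d := by nlinarith
        have h2 : 0 < (-(2 * (a - t) * T + t * (a * r + b))) * -T := by
          nlinarith [mul_pos ht (sub_pos.2 h1), mul_pos ha (sq_pos_of_neg hT0)]
        exact (pos_of_mul_pos_left h2 (by linarith)).le
      rw [hsq]
      field_simp
      ring
  refine ⟨-T, by linarith, by linarith, ?_, ?_⟩
  · rw [hξ]; field_simp; ring
  · rw [hξ]
    field_simp
    linear_combination hT

theorem decreasesTo_recRoot_one_of_lt_threshold {a d t : ℝ} (b r : ℝ) (ha : 0 < a) (ht : 0 < t)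
    (hd : d < 0) (hr : r < rThreshold a b d t) :
    DecreasesTo 1 (fun n => recRoot a b d t r n 1) (xiMinus a b d t r) := by
  have h : t * (a * r + b) < (a - 2 * t) * √(-d) := by
    have := mul_lt_mul_of_pos_left hr (mul_pos ha ht)
    have e : a * t * rThreshold a b d t = (a - 2 * t) * √(-d) - t * b := by
      rw [rThreshold]; field_simp; ring
    rw [e] at this
    linarith
  obtain ⟨m, hm, hms, h1, h2⟩ := xiMinus_spec ht hd h ha
  exact decreasesTo_recRoot_one_of_eigenvalue ha ht hd hm hms h1 h2

/-! ### Reflection, and the largest roots -/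

theorem eval_recPoly_neg (a b d t r x : ℝ) (n : ℕ) :
    (recPoly a (-b) d t (-r) n).eval x = (-1) ^ n * (recPoly a b d t r n).eval (-x) := by
  induction n using Nat.twoStepInduction with
  | zero => simp [eval_recPoly_zero]
  | one => rw [eval_recPoly_one, eval_recPoly_one]; ring
  | more n ih0 ih1 => rw [eval_recPoly_add_two, eval_recPoly_add_two, ih0, ih1]; ring

/-- The reflection `x ↦ -x` replaces `b` and `r` by `-b` and `-r` and reverses the order of the
roots. -/
theorem recRoot_neg {a d t : ℝ} (b r : ℝ) (ha : 0 < a) (ht : 0 < t) (hd : d < 0) {n j : ℕ}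
    (hj : 1 ≤ j) (hjn : j ≤ n) :
    recRoot a (-b) d t (-r) n j = -recRoot a b d t r n (n + 1 - j) := by
  have hc := card_zeroSet_recPoly (-b) (-r) ha ht hd n
  have hmono := nthSmallest_strictMonoOn (zeroSet (recPoly a b d t r n))
  rw [card_zeroSet_recPoly b r ha ht hd] at hmono
  refine nthSmallest_eq_of_strictMonoOn (f := fun j => -recRoot a b d t r n (n + 1 - j)) ?_ ?_
    (by rw [hc]; exact ⟨hj, hjn⟩)
  · rw [hc]
    rintro i ⟨hi, hi'⟩ k ⟨hk, hk'⟩ hik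
    exact neg_lt_neg (hmono ⟨by omega, by omega⟩ ⟨by omega, by omega⟩ (by omega))
  · rw [hc]
    rintro i ⟨hi, hi'⟩
    rw [mem_zeroSet (recPoly_ne_zero (-b) d (-r) ha ht n), eval_recPoly_neg, neg_neg,
      eval_recPoly_recRoot b r ha ht hd (by omega) (by omega), mul_zero]

theorem increasesTo_of_decreasesTo_neg {a d t : ℝ} (b r : ℝ) (ha : 0 < a) (ht : 0 < t)
    (hd : d < 0) {j : ℕ} (hj : 1 ≤ j) {l : ℝ}
    (h : DecreasesTo j (fun n => recRoot a (-b) d t (-r) n j) (-l)) :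
    IncreasesTo j (fun n => recRoot a b d t r n (n + 1 - j)) l := by
  have e : ∀ n, j ≤ n →
      recRoot a b d t r n (n + 1 - j) = -recRoot a (-b) d t (-r) n j := by
    intro n hn
    rw [recRoot_neg b r ha ht hd hj hn, neg_neg]
  constructor
  · intro n hn k hk hnk
    simp only
    rw [e n hn, e k hk]
    exact neg_lt_neg (h.1 hn hk hnk)
  · have h2 := h.2.neg
    rw [neg_neg] at h2
    refine h2.congr' ?_
    filter_upwards [eventually_ge_atTop j] with n hn
    exact (e n hn).symm

theorem xDeltaMinus_neg (a b d : ℝ) : xDeltaMinus a (-b) d = -xDeltaPlus a b d := by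
  rw [xDeltaMinus, xDeltaPlus]; ring

theorem xiMinus_neg (a b d t r : ℝ) : xiMinus a (-b) d t (-r) = -xiPlus a b d t r := by
  unfold xiMinus xiPlus
  split_ifs with h
  · rw [show a * -r + -b = -(a * r + b) by ring, mul_neg, div_neg]; ring
  · rw [show (a * -r + -b) ^ 2 = (a * r + b) ^ 2 by ring]; ring

theorem increasesTo_recRoot {a d t : ℝ} (b r : ℝ) (ha : 0 < a) (ht : 0 < t) (hd : d < 0) {j : ℕ}
    (hj : 2 ≤ j) :
    IncreasesTo j (fun n => recRoot a b d t r n (n + 1 - j)) (xDeltaPlus a b d) := by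
  refine increasesTo_of_decreasesTo_neg b r ha ht hd (by omega) ?_
  rw [← xDeltaMinus_neg]
  exact decreasesTo_recRoot (-b) (-r) ha ht hd hj

theorem increasesTo_recRoot_self_of_le_threshold {a d t : ℝ} (b r : ℝ) (ha : 0 < a) (ht : 0 < t)
    (hd : d < 0) (hr : rThreshold a (-b) d t ≤ -r) :
    IncreasesTo 1 (fun n => recRoot a b d t r n n) (xDeltaPlus a b d) := by
  refine increasesTo_of_decreasesTo_neg b r ha ht hd le_rfl ?_
  rw [← xDeltaMinus_neg]
  exact decreasesTo_recRoot_one_of_threshold_le (-b) (-r) ha ht hd hr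

theorem increasesTo_recRoot_self_of_threshold_lt {a d t : ℝ} (b r : ℝ) (ha : 0 < a) (ht : 0 < t)
    (hd : d < 0) (hr : -r < rThreshold a (-b) d t) :
    IncreasesTo 1 (fun n => recRoot a b d t r n n) (xiPlus a b d t r) := by
  refine increasesTo_of_decreasesTo_neg b r ha ht hd le_rfl ?_
  rw [← xiMinus_neg]
  exact decreasesTo_recRoot_one_of_lt_threshold (-b) (-r) ha ht hd hr

/-! ### Position of the threshold -/

theorem rMinus_neg (a b d t : ℝ) : rMinus a (-b) d t = -rPlus a b d t := by
  rw [rMinus, rPlus]; ring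

theorem rPlus_neg (a b d t : ℝ) : rPlus a (-b) d t = -rMinus a b d t := by
  rw [rMinus, rPlus]; ring

theorem rMinus_le_rThreshold {a t : ℝ} (b d : ℝ) (ha : 0 < a) (ht : 0 < t) :
    rMinus a b d t ≤ rThreshold a b d t := by
  have := neg_abs_le (a - 2 * t)
  have e : rMinus a b d t = -(b / a) + -|a - 2 * t| * √(-d) / (a * t) := by rw [rMinus]; ring
  rw [e, rThreshold]
  gcongr

theorem rThreshold_le_rPlus {a t : ℝ} (b d : ℝ) (ha : 0 < a) (ht : 0 < t) :
    rThreshold a b d t ≤ rPlus a b d t := by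
  rw [rPlus, rThreshold]
  gcongr
  exact le_abs_self _

theorem rThreshold_of_le {a t : ℝ} (b d : ℝ) (h : a ≤ 2 * t) :
    rThreshold a b d t = rMinus a b d t := by
  rw [rMinus, rThreshold, abs_of_nonpos (by linarith)]; ring

theorem rThreshold_of_ge {a t : ℝ} (b d : ℝ) (h : 2 * t ≤ a) :
    rThreshold a b d t = rPlus a b d t := by
  rw [rPlus, rThreshold, abs_of_nonneg (by linarith)]

theorem rMinus_lt_rPlus {a d t : ℝ} (b : ℝ) (ha : 0 < a) (ht : 0 < t) (hd : d < 0)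
    (h : 2 * t < a) : rMinus a b d t < rPlus a b d t := by
  have hs : 0 < √(-d) := Real.sqrt_pos.2 (by linarith)
  have : 0 < |a - 2 * t| := abs_pos.2 (by linarith)
  have : 0 < |a - 2 * t| * √(-d) / (a * t) := by positivity
  rw [rMinus, rPlus]
  linarith

theorem lt_rThreshold {a d t r : ℝ} (b : ℝ) (ha : 0 < a) (ht : 0 < t) (hd : d < 0)
    (h : (r = rMinus a b d t ∧ 2 * t < a) ∨ r < rMinus a b d t) : r < rThreshold a b d t := by
  rcases h with ⟨rfl, h⟩ | h
  · rw [rThreshold_of_ge b d h.le]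
    exact rMinus_lt_rPlus b ha ht hd h
  · exact h.trans_le (rMinus_le_rThreshold b d ha ht)

theorem rThreshold_le {a t r : ℝ} (b d : ℝ) (ha : 0 < a) (ht : 0 < t)
    (h : (r = rPlus a b d t ∧ 2 * t < a) ∨ rPlus a b d t < r) : rThreshold a b d t ≤ r := by
  rcases h with ⟨rfl, -⟩ | h
  · exact rThreshold_le_rPlus b d ha ht
  · exact (rThreshold_le_rPlus b d ha ht).trans h.le

theorem theorem2p1 (a b d t r : ℝ) (ha : 0 < a) (ht : 0 < t) (hd : d < 0) :
    (∀ n : ℕ, (recPoly a b d t r n).degree = (n : WithBot ℕ) ∧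
      IsDistinctRealRooted (recPoly a b d t r n) ∧
      (zeroSet (recPoly a b d t r n)).card = n) ∧
    (∀ n : ℕ, Interlaces (zeroSet (recPoly a b d t r (n + 1))) (zeroSet (recPoly a b d t r n))) ∧
    (∀ j : ℕ, 2 ≤ j →
      DecreasesTo j (fun n => recRoot a b d t r n j) (xDeltaMinus a b d) ∧
      IncreasesTo j (fun n => recRoot a b d t r n (n + 1 - j)) (xDeltaPlus a b d)) ∧
    ((rMinus a b d t ≤ r ∧ r ≤ rPlus a b d t) ∧ a ≤ 2 * t →
      DecreasesTo 1 (fun n => recRoot a b d t r n 1) (xDeltaMinus a b d) ∧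
      IncreasesTo 1 (fun n => recRoot a b d t r n n) (xDeltaPlus a b d)) ∧
    ((rMinus a b d t < r ∧ r < rPlus a b d t) ∧ 2 * t < a →
      DecreasesTo 1 (fun n => recRoot a b d t r n 1) (xiMinus a b d t r) ∧
      IncreasesTo 1 (fun n => recRoot a b d t r n n) (xiPlus a b d t r)) ∧
    ((r = rMinus a b d t ∧ 2 * t < a) ∨ r < rMinus a b d t →
      DecreasesTo 1 (fun n => recRoot a b d t r n 1) (xiMinus a b d t r) ∧
      IncreasesTo 1 (fun n => recRoot a b d t r n n) (xDeltaPlus a b d)) ∧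
    ((r = rPlus a b d t ∧ 2 * t < a) ∨ rPlus a b d t < r →
      DecreasesTo 1 (fun n => recRoot a b d t r n 1) (xDeltaMinus a b d) ∧
      IncreasesTo 1 (fun n => recRoot a b d t r n n) (xiPlus a b d t r)) := by
  refine ⟨fun n => ?_, interlaces_recPoly b r ha ht hd, fun j hj =>
    ⟨decreasesTo_recRoot b r ha ht hd hj, increasesTo_recRoot b r ha ht hd hj⟩, ?_, ?_, ?_, ?_⟩
  · have hcard := card_zeroSet_recPoly b r ha ht hd n
    exact ⟨(degree_and_leadingCoeff_recPoly b d r ha ht n).1,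
      isDistinctRealRooted_of_card_zeroSet (recPoly_ne_zero b d r ha ht n)
        (hcard.trans (natDegree_recPoly b d r ha ht n).symm), hcard⟩
  · rintro ⟨⟨h1, h2⟩, h⟩
    exact ⟨decreasesTo_recRoot_one_of_threshold_le b r ha ht hd (by rwa [rThreshold_of_le b d h]),
      increasesTo_recRoot_self_of_le_threshold b r ha ht hd
        (by rw [rThreshold_of_le (-b) d h, rMinus_neg]; exact neg_le_neg h2)⟩
  · rintro ⟨⟨h1, h2⟩, h⟩
    exact ⟨decreasesTo_recRoot_one_of_lt_threshold b r ha ht hd (by rwa [rThreshold_of_ge b d h.le]),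
      increasesTo_recRoot_self_of_threshold_lt b r ha ht hd
        (by rw [rThreshold_of_ge (-b) d h.le, rPlus_neg]; exact neg_lt_neg h1)⟩
  · intro h
    refine ⟨decreasesTo_recRoot_one_of_lt_threshold b r ha ht hd (lt_rThreshold b ha ht hd h),
      increasesTo_recRoot_self_of_le_threshold b r ha ht hd (rThreshold_le (-b) d ha ht ?_)⟩
    rwa [rPlus_neg, neg_inj, neg_lt_neg_iff]
  · intro h
    refine ⟨decreasesTo_recRoot_one_of_threshold_le b r ha ht hd (rThreshold_le b d ha ht h),
      increasesTo_recRoot_self_of_threshold_lt b r ha ht hd (lt_rThreshold (-b) ha ht hd ?_)⟩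
    rwa [rMinus_neg, neg_inj, neg_lt_neg_iff]
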